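/- Let $\Omega\subset\mathbb R^3$ be a bounded, simply connected polyhedral domain with outward unit normal $\boldsymbol n$, and let $\partial\Omega=\overline{\Gamma}_D\cup\overline{\Gamma}_N$ with $\Gamma_D,\Gamma_N$ disjoint and relatively open in $\partial\Omega$. Let $\Omega_1,\dots,\Omega_m$ be disjoint open subsets of $\Omega$ that fill $\Omega$ up to a null set, and let $PH^1$ be the space of fields in $L^2(\Omega)^3$ whose restriction to each $\Omega_j$ is in $H^1(\Omega_j)^3$. Let $\mu^{-1},\beta\in L^\infty(\Omega)$ with $\mu^{-1}\ge\mu_0^{-1}>0$ and $\beta\ge\beta_0>0$ a.e. All inner products $(\cdot,\cdot)$ and norms $\|\cdot\|$ are those of $L^2(\Omega)$. For $B\in\{D,N\}$ let $\mathring{H}_B(\mathrm{curl})=\{v\in H(\mathrm{curl};\Omega): v\times n=0\text{ on }\Gamma_B\}$, where $\mathring H_D(\mathrm{curl})$ is the closure in $H(\mathrm{curl};\Omega)$ of the smooth fields vanishing near $\Gamma_D$. For $u\in H(\mathrm{curl};\Omega)$ the tangential trace $u\times n$ on $\Gamma_N$ (resp. $\Gamma_D$) is the functional $v\mapsto\langle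 u\times n,v\rangle=(u,\mathrm{curl}\,v)-(\mathrm{curl}\,u,v)$ on $\mathring{H}_D(\mathrm{curl})$ (resp. $\mathring{H}_N(\mathrm{curl})$), and $\mathring H_N(\mathrm{curl})$ consists of the fields whose trace on $\Gamma_N$ is zero. Let $X_\parallel(\Gamma_N)$ be the set of the traces on $\Gamma_N$ of all $u\in H(\mathrm{curl};\Omega)$, and $H^{1/2}_\perp(\Gamma_D)$ the set of the traces on $\Gamma_D$ of all $u\in PH^1\cap H(\mathrm{curl};\Omega)$. Put $$A_{\beta,\mu}(\sigma,\tau)=(\beta^{-1}\mathrm{curl}\,\sigma,\mathrm{curl}\,\tau)+(\mu\sigma,\tau),\qquad |||\sigma|||_{\beta,\mu}=A_{\beta,\mu}(\sigma,\sigma)^{1/2}.$$ For $w\in H(\mathrm{curl};\Omega)$ with $\nabla\cdot(\beta w)\in L^2(\Omega)$ put $$E(w)=\bigl\{\|\mu^{-1/2}\mathrm{curl}\,w\|^2+\|\beta^{-1/2}\nabla\cdot(\beta w)\|^2+\|\beta^{1/2}w\|^2\bigr\}^{1/2}.$$ The weighted trace norms are as follows. * $\|g_D\|_{1/2,\mu,\beta,\Gamma_D}=\inf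 E(w)$ over all such $w$ with $w\times n=g_D$ on $\Gamma_D$. * For $v\in\mathring H_D(\mathrm{curl})$, $\|v\|_{1/2,\mu,\beta,\Gamma_N}=\inf E(w)$ over all such $w\in\mathring H_D(\mathrm{curl})$ with $w\times n=v\times n$ on $\partial\Omega$ (that is, $\langle w\times n,z\rangle=\langle v\times n,z\rangle$ for all $z\in H(\mathrm{curl};\Omega)$). * $\displaystyle\|g_N\|_{-1/2,\beta,\mu,\Gamma_N}=\sup_{v\in PH^1\cap\mathring H_D(\mathrm{curl})}\frac{\langle g_N,v\rangle_{\Gamma_N}}{\|v\|_{1/2,\mu,\beta,\Gamma_N}}$ (with $0/0=0$). **Theorem.** Let $f\in L^2(\Omega)^3$, $g_D\in H^{1/2}_\perp(\Gamma_D)$ and $g_N\in X_\parallel(\Gamma_N)$. Then there is exactly one $\sigma\in H(\mathrm{curl};\Omega)$ with $\sigma\times n=g_N$ on $\Gamma_N$ and $$A_{\beta,\mu}(\sigma,\tau)=(\beta^{-1}f,\mathrm{curl}\,\tau)-\langle g_D,\tau\rangle_{\Gamma_D}\qquad\text{for all }\tau\in\mathring H_N(\mathrm{curl}).$$ The two trace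 norms below are finite, and this $\sigma$ satisfies $$|||\sigma|||_{\beta,\mu}\le\|\beta^{-1/2}f\|+\|g_D\|_{1/2,\mu,\beta,\Gamma_D}+\|g_N\|_{-1/2,\beta,\mu,\Gamma_N}.$$ -/

import Mathlib

open MeasureTheory Set
open scoped ContDiff ENNReal

noncomputable section

namespace MagField

/-- Physical space `ℝ³` with its Euclidean norm. -/
abbrev E3 := EuclideanSpace ℝ (Fin 3)

/-! ### Domain, boundary parts, partition -/

/-- The plane `{x : a · x = c}`. -/
def plane (a : E3) (c : ℝ) : Set E3 := {x | inner ℝ a x = c}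

/-- A bounded polyhedral domain: a bounded connected open set, lying locally on one side of its
boundary (no cracks), whose boundary is contained in finitely many planes. -/
structure IsPolyhedralDomain (Ω : Set E3) : Prop where
  isOpen : IsOpen Ω
  isConnected : IsConnected Ω
  isBounded : Bornology.IsBounded Ω
  regular : interior (closure Ω) = Ω
  planes : ∃ (N : ℕ) (a : Fin N → E3) (c : Fin N → ℝ),
    (∀ i, a i ≠ 0) ∧ frontier Ω ⊆ ⋃ i, plane (a i) (c i)

/-- `∂Ω` is split into two disjoint relatively open parts `ΓD`, `ΓN` whose closures cover it. -/
structure IsBoundarySplitting (Ω ΓD ΓN : Set E3) : Prop where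
  openD : ∃ U, IsOpen U ∧ ΓD = U ∩ frontier Ω
  openN : ∃ U, IsOpen U ∧ ΓN = U ∩ frontier Ω
  disjoint : Disjoint ΓD ΓN
  cover : frontier Ω = closure ΓD ∪ closure ΓN

/-- `P 0, …, P (m-1)` are disjoint open subsets of `Ω` filling it up to a null set. -/
structure IsPartition (Ω : Set E3) {m : ℕ} (P : Fin m → Set E3) : Prop where
  isOpen : ∀ j, IsOpen (P j)
  subset : ∀ j, P j ⊆ Ω
  disjoint : Pairwise fun i j => Disjoint (P i) (P j)
  null : volume (Ω \ ⋃ j, P j) = 0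

/-- The assumptions on the coefficients: `μ⁻¹, β ∈ L^∞(Ω)`, both essentially bounded below by
positive constants. -/
structure IsCoefficientPair (Ω : Set E3) (μ β : E3 → ℝ) : Prop where
  memLp_mu : MemLp (fun x => (μ x)⁻¹) ∞ (volume.restrict Ω)
  memLp_beta : MemLp β ∞ (volume.restrict Ω)
  lower_mu : ∃ μ₀ : ℝ, 0 < μ₀ ∧ ∀ᵐ x ∂(volume.restrict Ω), μ₀⁻¹ ≤ (μ x)⁻¹
  lower_beta : ∃ β₀ : ℝ, 0 < β₀ ∧ ∀ᵐ x ∂(volume.restrict Ω), β₀ ≤ β x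

/-! ### Function spaces -/

/-- Square integrable vector fields on `Ω`. -/
abbrev L2vec (Ω : Set E3) := Lp E3 2 (volume.restrict Ω)

/-- Square integrable functions on `Ω`. -/
abbrev L2 (Ω : Set E3) := Lp ℝ 2 (volume.restrict Ω)

/-- The classical partial derivative `∂ₖ φᵢ (x)`. -/
def partialD (φ : E3 → E3) (k i : Fin 3) (x : E3) : ℝ :=
  (fderiv ℝ φ x (EuclideanSpace.single k 1)) i

/-- The classical curl of a vector field. -/
def curl (φ : E3 → E3) (x : E3) : E3 :=
  !₂[partialD φ 1 2 x - partialD φ 2 1 x,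
     partialD φ 2 0 x - partialD φ 0 2 x,
     partialD φ 0 1 x - partialD φ 1 0 x]

/-- Smooth functions with compact support in `U`. -/
def IsTest {F : Type*} [NormedAddCommGroup F] [NormedSpace ℝ F] (U : Set E3) (φ : E3 → F) : Prop :=
  ContDiff ℝ ∞ φ ∧ HasCompactSupport φ ∧ tsupport φ ⊆ U

/-- `H(curl;Ω)`. A field `u ∈ L²` whose weak curl `c` is in `L²` is represented by the pair
`(u, c)`; `c` is determined by `u`. -/
def Hcurl (Ω : Set E3) : Set (L2vec Ω × L2vec Ω) :=
  {u | ∀ φ : E3 → E3, IsTest Ω φ →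
    ∫ x in Ω, inner ℝ (u.1 x) (curl φ x) = ∫ x in Ω, inner ℝ (u.2 x) (φ x)}

/-- `d = ∇·(a v)` weakly in `Ω`. -/
def HasWeakDiv (Ω : Set E3) (a : E3 → ℝ) (v : L2vec Ω) (d : L2 Ω) : Prop :=
  ∀ φ : E3 → ℝ, IsTest Ω φ →
    ∫ x in Ω, a x * fderiv ℝ φ x (v x) = - ∫ x in Ω, d x * φ x

/-- `PH¹(Ω, P)`: square integrable fields with square integrable weak first derivatives on each
`P j`. -/
def PH1 (Ω : Set E3) {m : ℕ} (P : Fin m → Set E3) : Set (L2vec Ω) :=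
  {v | ∀ (j : Fin m) (i k : Fin 3), ∃ d : E3 → ℝ, MemLp d 2 (volume.restrict (P j)) ∧
    ∀ φ : E3 → ℝ, IsTest (P j) φ →
      ∫ x in P j, v x i * fderiv ℝ φ x (EuclideanSpace.single k 1) = - ∫ x in P j, d x * φ x}

/-! ### Tangential traces

By Green's formula `(u, curl v) - (curl u, v) = ∫_{∂Ω} (u × n) · v dS`, so the tangential trace
`u × n` of `u ∈ H(curl;Ω)` acts on `v ∈ H(curl;Ω)` through the form below. Its restriction to
`ΓN` acts on the `v` with `v × n = 0` on `ΓD`, and its restriction to `ΓD` acts on the `v` with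
`v × n = 0` on `ΓN`. -/

/-- `⟨u × n, v⟩_{∂Ω} = (u, curl v) - (curl u, v)`. -/
def bdry {Ω : Set E3} (u v : L2vec Ω × L2vec Ω) : ℝ :=
  inner ℝ u.1 v.2 - inner ℝ u.2 v.1

/-- Fields of `H(curl;Ω)` with `v × n = 0` on `ΓD`: the closure in `H(curl;Ω)` of the smooth
fields that vanish near `ΓD`. -/
def HcurlD0 (Ω ΓD : Set E3) : Set (L2vec Ω × L2vec Ω) :=
  closure {v | v ∈ Hcurl Ω ∧ ∃ φ : E3 → E3, ContDiff ℝ ∞ φ ∧ HasCompactSupport φ ∧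
    (∃ U, IsOpen U ∧ closure ΓD ⊆ U ∧ ∀ x ∈ U, φ x = 0) ∧
    v.1 =ᵐ[volume.restrict Ω] φ ∧ v.2 =ᵐ[volume.restrict Ω] curl φ}

/-- The tangential trace of `u` on `ΓN` (the part of `∂Ω` left over by `ΓD`), as the functional
`v ↦ ⟨u × n, v⟩_{ΓN}` on the fields `v` with `v × n = 0` on `ΓD`. -/
def traceN {Ω : Set E3} (ΓD : Set E3) (u : L2vec Ω × L2vec Ω) : HcurlD0 Ω ΓD → ℝ :=
  fun v => bdry u v.1

/-- Fields of `H(curl;Ω)` with `τ × n = 0` on `ΓN`. -/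
def HcurlN0 (Ω ΓD : Set E3) : Set (L2vec Ω × L2vec Ω) :=
  {τ | τ ∈ Hcurl Ω ∧ traceN ΓD τ = 0}

/-- The tangential trace of `w` on `ΓD`, as the functional `τ ↦ ⟨w × n, τ⟩_{ΓD}` on the fields
`τ` with `τ × n = 0` on `ΓN`. -/
def traceD {Ω : Set E3} (ΓD : Set E3) (w : L2vec Ω × L2vec Ω) : HcurlN0 Ω ΓD → ℝ :=
  fun τ => bdry w τ.1

/-- `X_∥(ΓN)`: the tangential traces on `ΓN` of all fields of `H(curl;Ω)`. -/
def XparN (Ω ΓD : Set E3) : Set (HcurlD0 Ω ΓD → ℝ) :=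
  traceN ΓD '' Hcurl Ω

/-- `H^{1/2}_⊥(ΓD)`: the tangential traces on `ΓD` of piecewise `H¹` fields. -/
def HhalfPerpD (Ω ΓD : Set E3) {m : ℕ} (P : Fin m → Set E3) : Set (HcurlN0 Ω ΓD → ℝ) :=
  traceD ΓD '' {w | w ∈ Hcurl Ω ∧ w.1 ∈ PH1 Ω P}

/-! ### Forms and norms -/

/-- `A_{a,b}(u,v) = (a⁻¹ curl u, curl v) + (b u, v)`. -/
def formA {Ω : Set E3} (a b : E3 → ℝ) (u v : L2vec Ω × L2vec Ω) : ℝ :=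
  (∫ x in Ω, (a x)⁻¹ * inner ℝ (u.2 x) (v.2 x)) + ∫ x in Ω, b x * inner ℝ (u.1 x) (v.1 x)

/-- The energy norm of `A_{a,b}`. -/
def energyNorm {Ω : Set E3} (a b : E3 → ℝ) (u : L2vec Ω × L2vec Ω) : ℝ :=
  √(formA a b u u)

/-- The infimum over the fields `w` in the class `C` with `∇·(b w) ∈ L²` of
`{‖a^{-1/2} curl w‖² + ‖b^{-1/2} ∇·(b w)‖² + ‖b^{1/2} w‖²}^{1/2}`; it is `∞` if there are none. -/
def infExtension {Ω : Set E3} (a b : E3 → ℝ) (C : Set (L2vec Ω × L2vec Ω)) : ℝ≥0∞ :=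
  ⨅ (w : L2vec Ω × L2vec Ω) (d : L2 Ω) (_ : w ∈ C ∧ HasWeakDiv Ω b w.1 d),
    ENNReal.ofReal √((∫ x in Ω, (a x)⁻¹ * ‖w.2 x‖ ^ 2) + (∫ x in Ω, (b x)⁻¹ * (d x) ^ 2)
      + ∫ x in Ω, b x * ‖w.1 x‖ ^ 2)

/-- `‖g‖_{1/2,a,b,ΓD}` of tangential data on `ΓD`: the infimum runs over all extensions. -/
def halfNormD {Ω ΓD : Set E3} (a b : E3 → ℝ) (g : HcurlN0 Ω ΓD → ℝ) : ℝ≥0∞ :=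
  infExtension a b {w | w ∈ Hcurl Ω ∧ traceD ΓD w = g}

/-- `‖v‖_{1/2,a,b,ΓN}` of the boundary value of a field `v` with `v × n = 0` on `ΓD`: the infimum
runs over all fields that vanish tangentially on `ΓD` and have the same tangential trace on the
whole of `∂Ω` as `v`. -/
def halfNormN {Ω ΓD : Set E3} (a b : E3 → ℝ) (v : HcurlD0 Ω ΓD) : ℝ≥0∞ :=
  infExtension a b {w | w ∈ HcurlD0 Ω ΓD ∧ ∀ z ∈ Hcurl Ω, bdry w z = bdry v.1 z}

/-- The dual norm `‖g‖_{-1/2,b,a,ΓN} = sup ⟨g, v⟩_{ΓN} / ‖v‖_{1/2,a,b,ΓN}` of tangential data on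
`ΓN`, the supremum running over the boundary values of the piecewise `H¹` fields `v` with
`v × n = 0` on `ΓD`. (When the denominator is zero, so is the numerator, and `0 / 0 = 0`.) -/
def negHalfNormN {Ω ΓD : Set E3} {m : ℕ} (P : Fin m → Set E3) (b a : E3 → ℝ)
    (g : HcurlD0 Ω ΓD → ℝ) : ℝ≥0∞ :=
  ⨆ (v : HcurlD0 Ω ΓD) (_ : v.1.1 ∈ PH1 Ω P), ENNReal.ofReal (g v) / halfNormN a b v

/-! ### The variational problem -/

/-- `σ ∈ H(curl;Ω)` with `σ × n = gN` on `ΓN` satisfies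
`A_{β,μ}(σ,τ) = (β⁻¹ f, curl τ) - ⟨gD, τ⟩_{ΓD}` for all `τ ∈ H(curl;Ω)` with `τ × n = 0` on
`ΓN`. -/
def IsMagSolution {Ω ΓD : Set E3} (μ β : E3 → ℝ) (f : L2vec Ω) (gD : HcurlN0 Ω ΓD → ℝ)
    (gN : HcurlD0 Ω ΓD → ℝ) (σ : L2vec Ω × L2vec Ω) : Prop :=
  σ ∈ Hcurl Ω ∧ traceN ΓD σ = gN ∧
    ∀ τ : HcurlN0 Ω ΓD,
      formA β μ σ τ.1 = (∫ x in Ω, (β x)⁻¹ * inner ℝ (f x) (τ.1.2 x)) - gD τ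

end MagField

end

/-!
The geometry of `Ω` plays almost no role: the argument is Hilbert space theory of the curl operator,
and the only fact used about the boundary is that `ΓD` stays away from the open set `Ω`.

*Energy isomorphism.* Multiplication by square roots of the weights (`energyEquiv`) turns `A_{a,b}`
into the inner product of `L² ⊕ L²`, so that Lax–Milgram is an orthogonal projection
(`exists_mem_forall_inner_sub_eq_zero`). The boundary pairing becomes
`⟨w × n, τ⟩ = A_{b,a}(w*, τ)` with `w* = (-a⁻¹ curl w, b w)`, and `w*` has the `A_{b,a}`-energy that
`w` has with respect to `A_{a,b}` (`bdry_eq_inner_energyEquiv`, `norm_energyEquiv_bdryRep`). This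
gives existence, uniqueness, and the estimate of the part of the solution caused by `f` and `gD`,
for every extension `w` of `gD` (`IsMagSolution.norm_sub_le`).

*Duality.* Let `σ` solve the problem with `f = 0` and `gD = 0`. The variational equation says that
the boundary pairing of `σ* = (-β⁻¹ curl σ, μ σ)` vanishes on the graph adjoint of `HcurlD0`. Since
`HcurlD0` is closed, it is the adjoint of its adjoint (`mem_of_adjoint_adjoint`); hence `σ*` belongs
to it, and `⟨gN, σ*⟩ = |||σ|||²` while `σ*` has energy norm `|||σ|||`.

*Comparison of norms.* The gradients of `H¹₀(Ω)` have no curl and no tangential trace, so projecting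
them out makes a field divergence-free without increasing its energy. Therefore the trace norms are
bounded by the energy norm (`halfNormN_le`, `halfNormD_le`), which makes them finite and continuous
enough to pass from the smooth fields, which are piecewise `H¹`, to all of `HcurlD0`
(`bdry_le_negHalfNormN`). Applied to `σ*` this gives `|||σ||| ≤ ‖gN‖_{-1/2}`.
-/

noncomputable section

namespace MagField

/-! ### Multiplication by weights -/

/-- Measurable weights on `Ω` that are essentially bounded above and below by positive constants. -/
structure IsWeight (Ω : Set E3) (a : E3 → ℝ) : Prop where
  aestronglyMeasurable : AEStronglyMeasurable a (volume.restrict Ω)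
  lower : ∃ c : ℝ, 0 < c ∧ ∀ᵐ x ∂(volume.restrict Ω), c ≤ a x
  upper : ∃ C : ℝ, ∀ᵐ x ∂(volume.restrict Ω), a x ≤ C

theorem IsWeight.pos {Ω : Set E3} {a : E3 → ℝ} (h : IsWeight Ω a) :
    ∀ᵐ x ∂(volume.restrict Ω), 0 < a x := by
  obtain ⟨c, hc, h⟩ := h.lower
  filter_upwards [h] with x hx using hc.trans_le hx

theorem isWeight_of_memLp {Ω : Set E3} {a : E3 → ℝ} (ha : MemLp a (⊤ : ℝ≥0∞) (volume.restrict Ω))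
    (hl : ∃ c : ℝ, 0 < c ∧ ∀ᵐ x ∂(volume.restrict Ω), c ≤ a x) : IsWeight Ω a := by
  refine ⟨ha.1, hl, (eLpNormEssSup a (volume.restrict Ω)).toReal, ?_⟩
  have hlt : eLpNormEssSup a (volume.restrict Ω) ≠ ⊤ := by
    have := ha.2
    rw [eLpNorm_exponent_top] at this
    exact this.ne
  filter_upwards [ae_le_eLpNormEssSup (f := a) (μ := volume.restrict Ω)] with x hx
  have := (ENNReal.toReal_le_toReal (by simp) hlt).2 hx
  rw [toReal_enorm] at this
  exact (le_abs_self _).trans this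

theorem IsWeight.inv {Ω : Set E3} {a : E3 → ℝ} (h : IsWeight Ω a) :
    IsWeight Ω (fun x => (a x)⁻¹) := by
  obtain ⟨c, hc, hl⟩ := h.lower
  obtain ⟨C, hu⟩ := h.upper
  refine ⟨h.aestronglyMeasurable.aemeasurable.inv.aestronglyMeasurable,
    ⟨(max C 1)⁻¹, by positivity, ?_⟩, c⁻¹, ?_⟩
  · filter_upwards [hu, h.pos] with x hx hp
    exact inv_anti₀ hp (hx.trans (le_max_left _ _))
  · filter_upwards [hl] with x hx
    exact inv_anti₀ hc hx

theorem IsWeight.sqrt {Ω : Set E3} {a : E3 → ℝ} (h : IsWeight Ω a) :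
    IsWeight Ω (fun x => √(a x)) := by
  obtain ⟨c, hc, hl⟩ := h.lower
  obtain ⟨C, hu⟩ := h.upper
  refine ⟨Real.continuous_sqrt.comp_aestronglyMeasurable h.aestronglyMeasurable,
    ⟨√c, Real.sqrt_pos.2 hc, ?_⟩, √C, ?_⟩
  · filter_upwards [hl] with x hx using Real.sqrt_le_sqrt hx
  · filter_upwards [hu] with x hx using Real.sqrt_le_sqrt hx

theorem IsWeight.memLp {Ω : Set E3} {a : E3 → ℝ} (h : IsWeight Ω a) :
    MemLp a (⊤ : ℝ≥0∞) (volume.restrict Ω) := by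
  obtain ⟨C, hu⟩ := h.upper
  refine memLp_top_of_bound h.aestronglyMeasurable C ?_
  filter_upwards [hu, h.pos] with x hx hp
  rwa [Real.norm_of_nonneg hp.le]

theorem IsWeight.exists_mul {Ω : Set E3} {a : E3 → ℝ} (h : IsWeight Ω a) :
    ∃ T : L2vec Ω →L[ℝ] L2vec Ω, ∀ u, T u =ᵐ[volume.restrict Ω] fun x => a x • u x := by
  refine ⟨(ContinuousLinearMap.lsmul ℝ ℝ : ℝ →L[ℝ] E3 →L[ℝ] E3).holderL
    (volume.restrict Ω) ⊤ 2 2 h.memLp.toLp, fun u => ?_⟩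
  have h1 := (ContinuousLinearMap.lsmul ℝ ℝ : ℝ →L[ℝ] E3 →L[ℝ] E3).coeFn_holder
    (r := 2) h.memLp.toLp u
  filter_upwards [h1, h.memLp.coeFn_toLp] with x hx hx'
  change (ContinuousLinearMap.holder 2 _ _ _ : L2vec Ω) x = _
  rw [hx, hx']
  rfl

theorem IsWeight.exists_sqrtMul {Ω : Set E3} {a : E3 → ℝ} (h : IsWeight Ω a) :
    ∃ T : L2vec Ω ≃L[ℝ] L2vec Ω,
      (∀ u, T u =ᵐ[volume.restrict Ω] fun x => √(a x) • u x) ∧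
      ∀ u, T.symm u =ᵐ[volume.restrict Ω] fun x => (√(a x))⁻¹ • u x := by
  obtain ⟨T, hT⟩ := h.sqrt.exists_mul
  obtain ⟨S, hS⟩ := h.sqrt.inv.exists_mul
  refine ⟨ContinuousLinearEquiv.equivOfInverse T S ?_ ?_, hT, hS⟩
  · intro u
    apply Lp.ext
    filter_upwards [hT u, hS (T u), h.sqrt.pos] with x h1 h2 h3
    rw [h2, h1, smul_smul, inv_mul_cancel₀ h3.ne', one_smul]
  · intro u
    apply Lp.ext
    filter_upwards [hS u, hT (S u), h.sqrt.pos] with x h1 h2 h3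
    rw [h2, h1, smul_smul, mul_inv_cancel₀ h3.ne', one_smul]

/-- Multiplication by `a^{1/2}` on `L²(Ω)³`. -/
def IsWeight.sqrtMul {Ω : Set E3} {a : E3 → ℝ} (h : IsWeight Ω a) : L2vec Ω ≃L[ℝ] L2vec Ω :=
  h.exists_sqrtMul.choose

theorem IsWeight.coeFn_sqrtMul {Ω : Set E3} {a : E3 → ℝ} (h : IsWeight Ω a) (u : L2vec Ω) :
    h.sqrtMul u =ᵐ[volume.restrict Ω] fun x => √(a x) • u x :=
  h.exists_sqrtMul.choose_spec.1 u

theorem IsWeight.coeFn_sqrtMul_symm {Ω : Set E3} {a : E3 → ℝ} (h : IsWeight Ω a) (u : L2vec Ω) :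
    h.sqrtMul.symm u =ᵐ[volume.restrict Ω] fun x => (√(a x))⁻¹ • u x :=
  h.exists_sqrtMul.choose_spec.2 u

theorem IsWeight.inner_sqrtMul_symm_left {Ω : Set E3} {a : E3 → ℝ} (h : IsWeight Ω a)
    (u v : L2vec Ω) : inner ℝ (h.sqrtMul.symm u) (h.sqrtMul v) = inner ℝ u v := by
  simp only [L2.inner_def]
  refine integral_congr_ae ?_
  filter_upwards [h.coeFn_sqrtMul_symm u, h.coeFn_sqrtMul v, h.sqrt.pos] with x h1 h2 h3
  rw [h1, h2, real_inner_smul_left, real_inner_smul_right]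
  field_simp

theorem IsWeight.inner_sqrtMul {Ω : Set E3} {a : E3 → ℝ} (h : IsWeight Ω a) (u v : L2vec Ω) :
    inner ℝ (h.sqrtMul u) (h.sqrtMul v) = ∫ x in Ω, a x * inner ℝ (u x) (v x) := by
  rw [L2.inner_def]
  refine integral_congr_ae ?_
  filter_upwards [h.coeFn_sqrtMul u, h.coeFn_sqrtMul v, h.pos] with x h1 h2 h3
  rw [h1, h2, real_inner_smul_left, real_inner_smul_right, ← mul_assoc, Real.mul_self_sqrt h3.le]

theorem IsWeight.inner_sqrtMul_symm {Ω : Set E3} {a : E3 → ℝ} (h : IsWeight Ω a)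
    (u v : L2vec Ω) : inner ℝ (h.sqrtMul.symm u) (h.sqrtMul.symm v)
      = ∫ x in Ω, (a x)⁻¹ * inner ℝ (u x) (v x) := by
  rw [L2.inner_def]
  refine integral_congr_ae ?_
  filter_upwards [h.coeFn_sqrtMul_symm u, h.coeFn_sqrtMul_symm v, h.pos] with x h1 h2 h3
  rw [h1, h2, real_inner_smul_left, real_inner_smul_right, ← mul_assoc, ← mul_inv,
    Real.mul_self_sqrt h3.le]

theorem IsWeight.norm_sq_sqrtMul {Ω : Set E3} {a : E3 → ℝ} (h : IsWeight Ω a) (u : L2vec Ω) :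
    ‖h.sqrtMul u‖ ^ 2 = ∫ x in Ω, a x * ‖u x‖ ^ 2 := by
  simp only [← real_inner_self_eq_norm_sq, h.inner_sqrtMul]

theorem IsWeight.norm_sq_sqrtMul_symm {Ω : Set E3} {a : E3 → ℝ} (h : IsWeight Ω a)
    (u : L2vec Ω) : ‖h.sqrtMul.symm u‖ ^ 2 = ∫ x in Ω, (a x)⁻¹ * ‖u x‖ ^ 2 := by
  simp only [← real_inner_self_eq_norm_sq, h.inner_sqrtMul_symm]

/-! ### The energy inner product -/

/-- The Hilbert space `L²(Ω)³ ⊕ L²(Ω)³`. -/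
abbrev L2pair (Ω : Set E3) := WithLp 2 (L2vec Ω × L2vec Ω)

/-- The isomorphism `(u, c) ↦ (a^{-1/2} c, b^{1/2} u)`. It turns the form `A_{a,b}` into the inner
product of `L²(Ω)³ ⊕ L²(Ω)³`. -/
def energyEquiv {Ω : Set E3} {a b : E3 → ℝ} (ha : IsWeight Ω a) (hb : IsWeight Ω b) :
    (L2vec Ω × L2vec Ω) ≃L[ℝ] L2pair Ω :=
  ((ContinuousLinearEquiv.prodComm ℝ _ _).trans
    (ha.sqrtMul.symm.prodCongr hb.sqrtMul)).trans
      (WithLp.prodContinuousLinearEquiv 2 ℝ _ _).symm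

section

variable {Ω : Set E3} {a b : E3 → ℝ} (ha : IsWeight Ω a) (hb : IsWeight Ω b)

theorem inner_energyEquiv' (u v : L2vec Ω × L2vec Ω) :
    inner ℝ (energyEquiv ha hb u) (energyEquiv ha hb v) =
      inner ℝ (ha.sqrtMul.symm u.2) (ha.sqrtMul.symm v.2)
        + inner ℝ (hb.sqrtMul u.1) (hb.sqrtMul v.1) := rfl

theorem inner_energyEquiv (u v : L2vec Ω × L2vec Ω) :
    inner ℝ (energyEquiv ha hb u) (energyEquiv ha hb v) = formA a b u v := by
  rw [inner_energyEquiv', ha.inner_sqrtMul_symm, hb.inner_sqrtMul, formA]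

theorem inner_energyEquiv_sub_left (u u' v : L2vec Ω × L2vec Ω) :
    inner ℝ (energyEquiv ha hb (u - u')) (energyEquiv ha hb v) =
      inner ℝ (energyEquiv ha hb u) (energyEquiv ha hb v)
        - inner ℝ (energyEquiv ha hb u') (energyEquiv ha hb v) := by
  rw [(energyEquiv ha hb).map_sub, inner_sub_left]

theorem norm_energyEquiv_sub_le (u u' : L2vec Ω × L2vec Ω) :
    ‖energyEquiv ha hb (u - u')‖ ≤ ‖energyEquiv ha hb u‖ + ‖energyEquiv ha hb u'‖ := by
  rw [(energyEquiv ha hb).map_sub]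
  exact norm_sub_le _ _

theorem energyNorm_eq (u : L2vec Ω × L2vec Ω) :
    energyNorm a b u = ‖energyEquiv ha hb u‖ := by
  rw [energyNorm, ← inner_energyEquiv ha hb, real_inner_self_eq_norm_sq,
    Real.sqrt_sq (norm_nonneg _)]

/-- The pair `w* = (-a⁻¹ curl w, b w)`, which represents the boundary pairing with `w` in the energy
inner product: `⟨w × n, τ⟩ = A_{b,a}(w*, τ)`. -/
def bdryRep (w : L2vec Ω × L2vec Ω) : L2vec Ω × L2vec Ω :=
  (- ha.sqrtMul.symm (ha.sqrtMul.symm w.2), hb.sqrtMul (hb.sqrtMul w.1))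

theorem bdry_eq_inner_energyEquiv (w τ : L2vec Ω × L2vec Ω) :
    bdry w τ = inner ℝ (energyEquiv hb ha (bdryRep ha hb w)) (energyEquiv hb ha τ) := by
  rw [inner_energyEquiv', bdry]
  simp only [bdryRep, map_neg, ContinuousLinearEquiv.symm_apply_apply,
    ContinuousLinearEquiv.apply_symm_apply, inner_neg_left]
  rw [real_inner_comm τ.2, ← hb.inner_sqrtMul_symm_left τ.2, ← ha.inner_sqrtMul_symm_left w.2,
    real_inner_comm (hb.sqrtMul w.1)]
  rfl

theorem norm_energyEquiv_bdryRep (w : L2vec Ω × L2vec Ω) :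
    ‖energyEquiv hb ha (bdryRep ha hb w)‖ = ‖energyEquiv ha hb w‖ := by
  have h : ‖energyEquiv hb ha (bdryRep ha hb w)‖ ^ 2 = ‖energyEquiv ha hb w‖ ^ 2 := by
    simp only [← real_inner_self_eq_norm_sq, inner_energyEquiv', bdryRep, map_neg,
      ContinuousLinearEquiv.symm_apply_apply, ContinuousLinearEquiv.apply_symm_apply,
      inner_neg_neg]
    exact add_comm _ _
  exact (sq_eq_sq₀ (norm_nonneg _) (norm_nonneg _)).1 h

theorem abs_bdry_le (w τ : L2vec Ω × L2vec Ω) :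
    |bdry w τ| ≤ ‖energyEquiv ha hb w‖ * ‖energyEquiv hb ha τ‖ := by
  rw [bdry_eq_inner_energyEquiv ha hb, ← norm_energyEquiv_bdryRep]
  exact abs_real_inner_le_norm _ _

end

/-! ### Projections and adjoints in Hilbert space -/

theorem norm_le_norm_add_of_inner_eq_zero {H : Type*} [NormedAddCommGroup H]
    [InnerProductSpace ℝ H] {x y : H} (h : inner ℝ x y = (0 : ℝ)) : ‖x‖ ≤ ‖x + y‖ := by
  refine nonneg_le_nonneg_of_sq_le_sq (norm_nonneg _) ?_
  rw [norm_add_sq_eq_norm_sq_add_norm_sq_of_inner_eq_zero _ _ h]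
  exact le_add_of_nonneg_right (mul_self_nonneg _)

/-- Existence of the orthogonal projection onto a closed subspace with respect to the inner product
pulled back along an isomorphism `R` onto a Hilbert space. -/
theorem exists_mem_forall_inner_sub_eq_zero {V H : Type*} [NormedAddCommGroup V]
    [NormedSpace ℝ V] [NormedAddCommGroup H] [InnerProductSpace ℝ H] [CompleteSpace H]
    (R : V ≃L[ℝ] H) (K : Submodule ℝ V) (hK : IsClosed (K : Set V)) (x : V) :
    ∃ k ∈ K, ∀ y ∈ K, inner ℝ (R (x - k)) (R y) = 0 := by
  have hcl : IsClosed ((K.map R.toLinearMap : Submodule ℝ H) : Set H) := by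
    rw [Submodule.map_coe]
    exact R.toHomeomorph.isClosedMap _ hK
  have : CompleteSpace (K.map R.toLinearMap : Submodule ℝ H) := hcl.completeSpace_coe
  obtain ⟨k, hk, hkx⟩ := ((K.map R.toLinearMap).starProjection_apply_mem (R x))
  refine ⟨k, hk, fun y hy => ?_⟩
  have h := (K.map R.toLinearMap).starProjection_inner_eq_zero (𝕜 := ℝ) (R x) (R y)
    ⟨y, hy, rfl⟩
  rw [← hkx] at h
  rw [map_sub]
  exact h

/-- A closed subspace of pairs is the adjoint of its adjoint (in the sense of graphs of linear
relations). -/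
theorem mem_of_adjoint_adjoint {H : Type*} [NormedAddCommGroup H] [InnerProductSpace ℝ H]
    [CompleteSpace H] (D : Submodule ℝ (H × H)) (hD : IsClosed (D : Set (H × H))) (w : H × H)
    (hw : ∀ τ : H × H, (∀ v ∈ D, inner ℝ τ.1 v.2 - inner ℝ τ.2 v.1 = 0) →
      inner ℝ w.1 τ.2 - inner ℝ w.2 τ.1 = 0) : w ∈ D := by
  obtain ⟨k, hk, h⟩ := exists_mem_forall_inner_sub_eq_zero
    (WithLp.prodContinuousLinearEquiv 2 ℝ H H).symm D hD w
  -- `(q, -p)` lies in the adjoint of `D` when `(p, q) = w - k` is orthogonal to `D`.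
  have hτ : ∀ v ∈ D, inner ℝ (w - k).2 v.2 - inner ℝ (-(w - k).1) v.1 = 0 := by
    intro v hv
    have h' : inner ℝ (w - k).1 v.1 + inner ℝ (w - k).2 v.2 = (0 : ℝ) := h v hv
    rw [inner_neg_left]
    linarith
  have h1 := hw ((w - k).2, -(w - k).1) hτ
  have h2 := hτ k hk
  have h3 : inner ℝ (w - k).1 (w - k).1 + inner ℝ (w - k).2 (w - k).2 = (0 : ℝ) := by
    simp only [Prod.fst_sub, Prod.snd_sub, inner_sub_left, inner_sub_right,
      inner_neg_right, real_inner_comm k.1, real_inner_comm k.2] at h1 h2 ⊢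
    linarith
  have h4 := real_inner_self_nonneg (x := (w - k).1)
  have h5 := real_inner_self_nonneg (x := (w - k).2)
  have h6 : (w - k).1 = 0 := inner_self_eq_zero.1 (le_antisymm (by linarith) h4 : _ = (0 : ℝ))
  have h7 : (w - k).2 = 0 := inner_self_eq_zero.1 (le_antisymm (by linarith) h5 : _ = (0 : ℝ))
  have : w = k := sub_eq_zero.1 (Prod.ext h6 h7)
  exact this ▸ hk

/-! ### Smooth compactly supported fields -/

theorem partialD_eq {φ : E3 → E3} (hφ : ContDiff ℝ ∞ φ) (k i : Fin 3) (x : E3) :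
    partialD φ k i x = fderiv ℝ (fun y => φ y i) x (EuclideanSpace.single k 1) := by
  have h : HasFDerivAt (fun y => φ y i)
      ((EuclideanSpace.proj i : E3 →L[ℝ] ℝ).comp (fderiv ℝ φ x)) x :=
    (EuclideanSpace.proj i : E3 →L[ℝ] ℝ).hasFDerivAt.comp x
      (hφ.differentiable (by simp) x).hasFDerivAt
  rw [h.fderiv]
  rfl

theorem contDiff_apply {φ : E3 → E3} (hφ : ContDiff ℝ ∞ φ) (i : Fin 3) :
    ContDiff ℝ ∞ (fun y => φ y i) :=
  (EuclideanSpace.proj i : E3 →L[ℝ] ℝ).contDiff.comp hφ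

theorem continuous_partialD {φ : E3 → E3} (hφ : ContDiff ℝ ∞ φ) (k i : Fin 3) :
    Continuous (partialD φ k i) := by
  have := (hφ.continuous_fderiv (by simp)).clm_apply
    (continuous_const (y := (EuclideanSpace.single k 1 : E3)))
  exact (EuclideanSpace.proj i : E3 →L[ℝ] ℝ).continuous.comp this

theorem tsupport_apply_subset (φ : E3 → E3) (i : Fin 3) :
    tsupport (fun y => φ y i) ⊆ tsupport φ := by
  refine closure_mono fun x hx => ?_
  rw [Function.mem_support] at hx ⊢
  intro h
  simp [h] at hx

theorem support_partialD_subset (φ : E3 → E3) (k i : Fin 3) :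
    Function.support (partialD φ k i) ⊆ tsupport φ := by
  intro x hx
  by_contra h
  refine hx ?_
  have h0 : fderiv ℝ φ x = 0 :=
    Function.notMem_support.1 fun h' => h (support_fderiv_subset ℝ h')
  simp [partialD, h0]

theorem continuous_curl {φ : E3 → E3} (hφ : ContDiff ℝ ∞ φ) : Continuous (curl φ) := by
  have := fun k i => continuous_partialD hφ k i
  unfold curl
  refine (PiLp.continuous_toLp 2 _).comp (continuous_pi fun i => ?_)
  fin_cases i <;> simp <;> fun_prop

theorem curl_eq_zero_of_notMem {φ : E3 → E3} {x : E3} (hx : x ∉ tsupport φ) : curl φ x = 0 := by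
  have h : ∀ k i, partialD φ k i x = 0 := fun k i =>
    Function.notMem_support.1 fun h => hx (support_partialD_subset φ k i h)
  ext i
  fin_cases i <;> simp [curl, h]

theorem hasCompactSupport_curl {φ : E3 → E3} (hφ : HasCompactSupport φ) :
    HasCompactSupport (curl φ) :=
  HasCompactSupport.intro hφ fun _ hx => curl_eq_zero_of_notMem hx

theorem curl_add {φ ψ : E3 → E3} (hφ : ContDiff ℝ ∞ φ) (hψ : ContDiff ℝ ∞ ψ) (x : E3) :
    curl (φ + ψ) x = curl φ x + curl ψ x := by
  have h : ∀ k i, partialD (φ + ψ) k i x = partialD φ k i x + partialD ψ k i x := fun k i => by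
    simp [partialD, fderiv_add (hφ.differentiable (by simp) x) (hψ.differentiable (by simp) x)]
  ext i
  fin_cases i <;> simp [curl, h] <;> ring

theorem curl_const_smul {φ : E3 → E3} (hφ : ContDiff ℝ ∞ φ) (c : ℝ) (x : E3) :
    curl (c • φ) x = c • curl φ x := by
  have h : ∀ k i, partialD (c • φ) k i x = c * partialD φ k i x := fun k i => by
    simp [partialD, fderiv_const_smul (hφ.differentiable (by simp) x)]
  ext i
  fin_cases i <;> simp [curl, h] <;> ring

theorem setIntegral_mul_fderiv {U : Set E3} {f g : E3 → ℝ} (hf : ContDiff ℝ ∞ f)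
    (hg : IsTest U g) (v : E3) :
    ∫ x in U, f x * fderiv ℝ g x v = - ∫ x in U, fderiv ℝ f x v * g x := by
  obtain ⟨hg, hgc, hgU⟩ := hg
  have hdf : Continuous fun x => fderiv ℝ f x v :=
    (hf.continuous_fderiv (by simp)).clm_apply continuous_const
  have hdg : Continuous fun x => fderiv ℝ g x v :=
    (hg.continuous_fderiv (by simp)).clm_apply continuous_const
  have hdgc : HasCompactSupport fun x => fderiv ℝ g x v := hgc.fderiv_apply ℝ v
  rw [setIntegral_eq_integral_of_forall_compl_eq_zero,
    setIntegral_eq_integral_of_forall_compl_eq_zero]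
  · exact integral_mul_fderiv_eq_neg_fderiv_mul_of_integrable
      ((hdf.mul hg.continuous).integrable_of_hasCompactSupport hgc.mul_left)
      ((hf.continuous.mul hdg).integrable_of_hasCompactSupport hdgc.mul_left)
      ((hf.continuous.mul hg.continuous).integrable_of_hasCompactSupport hgc.mul_left)
      (fun x _ => hf.differentiable (by simp) x) (fun x _ => hg.differentiable (by simp) x)
  · intro x hx
    rw [image_eq_zero_of_notMem_tsupport fun h => hx (hgU h), mul_zero]
  · intro x hx
    have h0 : fderiv ℝ g x = 0 :=
      Function.notMem_support.1 fun h => hx (hgU (support_fderiv_subset ℝ h))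
    simp [h0]

theorem integral_sub_add_sub_add_sub {X : Type*} [MeasurableSpace X] {ν : Measure X}
    {f₁ f₂ f₃ f₄ f₅ f₆ : X → ℝ} (h₁ : Integrable f₁ ν) (h₂ : Integrable f₂ ν)
    (h₃ : Integrable f₃ ν) (h₄ : Integrable f₄ ν) (h₅ : Integrable f₅ ν) (h₆ : Integrable f₆ ν) :
    ∫ x, (f₁ x - f₂ x) + (f₃ x - f₄ x) + (f₅ x - f₆ x) ∂ν =
      (∫ x, f₁ x ∂ν - ∫ x, f₂ x ∂ν) + (∫ x, f₃ x ∂ν - ∫ x, f₄ x ∂ν)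
        + (∫ x, f₅ x ∂ν - ∫ x, f₆ x ∂ν) := by
  have h12 : Integrable (fun x => f₁ x - f₂ x) ν := h₁.sub h₂
  have h34 : Integrable (fun x => f₃ x - f₄ x) ν := h₃.sub h₄
  have h56 : Integrable (fun x => f₅ x - f₆ x) ν := h₅.sub h₆
  have h14 : Integrable (fun x => (f₁ x - f₂ x) + (f₃ x - f₄ x)) ν := h12.add h34
  rw [integral_add h14 h56, integral_add h12 h34, integral_sub h₁ h₂, integral_sub h₃ h₄,
    integral_sub h₅ h₆]

/-- The curl is formally self-adjoint. -/
theorem setIntegral_inner_curl {U : Set E3} {φ ψ : E3 → E3} (hφ : ContDiff ℝ ∞ φ)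
    (hψ : IsTest U ψ) :
    ∫ x in U, inner ℝ (φ x) (curl ψ x) = ∫ x in U, inner ℝ (curl φ x) (ψ x) := by
  obtain ⟨hψ, hψc, hψU⟩ := hψ
  have htest : ∀ i, IsTest U fun y => ψ y i := fun i => ⟨contDiff_apply hψ i,
    hψc.mono' (subset_tsupport _ |>.trans (tsupport_apply_subset ψ i)),
    (tsupport_apply_subset ψ i).trans hψU⟩
  have key : ∀ i k j, ∫ x in U, φ x i * partialD ψ k j x
      = - ∫ x in U, partialD φ k i x * ψ x j := fun i k j => by
    simp only [partialD_eq hψ, partialD_eq hφ]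
    exact setIntegral_mul_fderiv (contDiff_apply hφ i) (htest j) _
  have int1 : ∀ i k j, Integrable (fun x => φ x i * partialD ψ k j x) (volume.restrict U) :=
    fun i k j => (((contDiff_apply hφ i).continuous.mul
      (continuous_partialD hψ k j)).integrable_of_hasCompactSupport
        (HasCompactSupport.mul_left (hψc.mono' (support_partialD_subset ψ k j)))).restrict
  have int2 : ∀ i k j, Integrable (fun x => partialD φ k i x * ψ x j) (volume.restrict U) :=
    fun i k j => (((continuous_partialD hφ k i).mul
      (contDiff_apply hψ j).continuous).integrable_of_hasCompactSupport
        (HasCompactSupport.mul_left (htest j).2.1)).restrict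
  have e1 : ∀ x, inner ℝ (φ x) (curl ψ x) =
      (φ x 0 * partialD ψ 1 2 x - φ x 0 * partialD ψ 2 1 x) +
      (φ x 1 * partialD ψ 2 0 x - φ x 1 * partialD ψ 0 2 x) +
      (φ x 2 * partialD ψ 0 1 x - φ x 2 * partialD ψ 1 0 x) := fun x => by
    simp [PiLp.inner_apply, Fin.sum_univ_three, curl]
    ring
  have e2 : ∀ x, inner ℝ (curl φ x) (ψ x) =
      (partialD φ 1 2 x * ψ x 0 - partialD φ 2 1 x * ψ x 0) +
      (partialD φ 2 0 x * ψ x 1 - partialD φ 0 2 x * ψ x 1) +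
      (partialD φ 0 1 x * ψ x 2 - partialD φ 1 0 x * ψ x 2) := fun x => by
    simp [PiLp.inner_apply, Fin.sum_univ_three, curl]
    ring
  simp only [e1, e2]
  rw [integral_sub_add_sub_add_sub (int1 _ _ _) (int1 _ _ _) (int1 _ _ _) (int1 _ _ _)
      (int1 _ _ _) (int1 _ _ _), integral_sub_add_sub_add_sub (int2 _ _ _) (int2 _ _ _)
      (int2 _ _ _) (int2 _ _ _) (int2 _ _ _) (int2 _ _ _)]
  simp only [key]
  ring

theorem contDiff_gradient {φ : E3 → ℝ} (hφ : ContDiff ℝ ∞ φ) : ContDiff ℝ ∞ (gradient φ) :=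
  (InnerProductSpace.toDual ℝ E3).symm.toContinuousLinearEquiv.toContinuousLinearMap.contDiff.comp
    (hφ.fderiv_right (by simp))

theorem support_gradient_subset (φ : E3 → ℝ) : Function.support (gradient φ) ⊆ tsupport φ := by
  intro x hx
  by_contra h
  refine hx ?_
  have h0 : fderiv ℝ φ x = 0 :=
    Function.notMem_support.1 fun h' => h (support_fderiv_subset ℝ h')
  simp [gradient, h0]

theorem isTest_gradient {U : Set E3} {φ : E3 → ℝ} (hφ : IsTest U φ) : IsTest U (gradient φ) :=
  ⟨contDiff_gradient hφ.1, hφ.2.1.mono' (support_gradient_subset φ),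
    (closure_minimal (support_gradient_subset φ) (isClosed_tsupport φ)).trans hφ.2.2⟩

theorem curl_gradient {φ : E3 → ℝ} (hφ : ContDiff ℝ ∞ φ) (x : E3) :
    curl (gradient φ) x = 0 := by
  have hd : ∀ i k, partialD (gradient φ) k i x =
      fderiv ℝ (fderiv ℝ φ) x (EuclideanSpace.single k 1) (EuclideanSpace.single i 1) := by
    intro i k
    have h : HasFDerivAt (gradient φ)
        ((InnerProductSpace.toDual ℝ E3).symm.toContinuousLinearEquiv.toContinuousLinearMap.comp
          (fderiv ℝ (fderiv ℝ φ) x)) x :=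
      ((InnerProductSpace.toDual ℝ
        E3).symm.toContinuousLinearEquiv.toContinuousLinearMap.hasFDerivAt).comp x
        (((hφ.fderiv_right (m := ∞) (by simp)).differentiable (by simp) x).hasFDerivAt)
    rw [partialD, h.fderiv, ← InnerProductSpace.toDual_symm_apply (𝕜 := ℝ),
      EuclideanSpace.inner_single_right]
    simp
  have hs : IsSymmSndFDerivAt ℝ φ x :=
    hφ.contDiffAt.isSymmSndFDerivAt (by
    simpa using WithTop.coe_le_coe.2 (le_top (a := (2 : ℕ∞))))
  have hs' : ∀ i k, partialD (gradient φ) k i x = partialD (gradient φ) i k x := fun i k => by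
    rw [hd, hd, hs.eq]
  ext i
  fin_cases i <;> simp [curl] <;> rw [hs'] <;> simp

/-! ### The boundary pairing and the spaces with vanishing traces -/

/-- The pair `(φ, curl φ)` of a smooth compactly supported field. -/
def smoothPair (Ω : Set E3) {φ : E3 → E3} (hφ : ContDiff ℝ ∞ φ) (hc : HasCompactSupport φ) :
    L2vec Ω × L2vec Ω :=
  ((hφ.continuous.memLp_of_hasCompactSupport hc).toLp φ,
    ((continuous_curl hφ).memLp_of_hasCompactSupport (hasCompactSupport_curl hc)).toLp (curl φ))

section

variable {Ω ΓD : Set E3}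

theorem smoothPair_fst {φ : E3 → E3} (hφ : ContDiff ℝ ∞ φ) (hc : HasCompactSupport φ) :
    (smoothPair Ω hφ hc).1 =ᵐ[volume.restrict Ω] φ :=
  (hφ.continuous.memLp_of_hasCompactSupport hc).coeFn_toLp

theorem smoothPair_snd {φ : E3 → E3} (hφ : ContDiff ℝ ∞ φ) (hc : HasCompactSupport φ) :
    (smoothPair Ω hφ hc).2 =ᵐ[volume.restrict Ω] curl φ :=
  ((continuous_curl hφ).memLp_of_hasCompactSupport (hasCompactSupport_curl hc)).coeFn_toLp

theorem bdry_smoothPair {φ : E3 → E3} (hφ : ContDiff ℝ ∞ φ) (hc : HasCompactSupport φ)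
    (u : L2vec Ω × L2vec Ω) : bdry u (smoothPair Ω hφ hc) =
      (∫ x in Ω, inner ℝ (u.1 x) (curl φ x)) - ∫ x in Ω, inner ℝ (u.2 x) (φ x) := by
  rw [bdry, L2.inner_def, L2.inner_def]
  congr 1
  · refine integral_congr_ae ?_
    filter_upwards [smoothPair_snd (Ω := Ω) hφ hc] with x hx
    rw [hx]
  · refine integral_congr_ae ?_
    filter_upwards [smoothPair_fst (Ω := Ω) hφ hc] with x hx
    rw [hx]

theorem bdry_swap (u v : L2vec Ω × L2vec Ω) : bdry u v = - bdry v u := by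
  simp only [bdry, real_inner_comm v.1, real_inner_comm v.2]
  ring

theorem bdry_sub_left (u u' v : L2vec Ω × L2vec Ω) : bdry (u - u') v = bdry u v - bdry u' v := by
  simp only [bdry, Prod.fst_sub, Prod.snd_sub, inner_sub_left]
  ring

theorem continuous_bdry_left (v : L2vec Ω × L2vec Ω) : Continuous fun u => bdry u v := by
  unfold bdry
  fun_prop

theorem continuous_bdry_right (u : L2vec Ω × L2vec Ω) : Continuous fun v => bdry u v := by
  unfold bdry
  fun_prop

/-- The fields whose boundary pairing with all members of `S` vanishes. Both `H(curl;Ω)` and its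
subspace of fields with zero trace on `ΓN` are of this form. -/
def bdryAnnihilator (S : Set (L2vec Ω × L2vec Ω)) : Submodule ℝ (L2vec Ω × L2vec Ω) where
  carrier := {u | ∀ v ∈ S, bdry u v = 0}
  zero_mem' v _ := by simp [bdry]
  add_mem' {u u'} hu hu' v hv := by
    have h := hu v hv
    have h' := hu' v hv
    simp only [bdry, Prod.fst_add, Prod.snd_add, inner_add_left] at h h' ⊢
    linarith
  smul_mem' c u hu v hv := by
    have h := hu v hv
    simp only [bdry, Prod.smul_fst, Prod.smul_snd, real_inner_smul_left] at h ⊢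
    rw [← mul_sub, h, mul_zero]

theorem isClosed_bdryAnnihilator (S : Set (L2vec Ω × L2vec Ω)) :
    IsClosed (bdryAnnihilator S : Set (L2vec Ω × L2vec Ω)) := by
  have : (bdryAnnihilator S : Set (L2vec Ω × L2vec Ω)) = ⋂ v ∈ S, {u | bdry u v = 0} := by
    ext u
    simp [bdryAnnihilator]
  rw [this]
  exact isClosed_biInter fun v _ => isClosed_eq (continuous_bdry_left v) continuous_const

theorem Hcurl_eq : Hcurl Ω = bdryAnnihilator
    {v | ∃ (φ : E3 → E3) (h : IsTest Ω φ), v = smoothPair Ω h.1 h.2.1} := by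
  ext u
  constructor
  · rintro hu _ ⟨φ, h, rfl⟩
    rw [bdry_smoothPair, hu φ h, sub_self]
  · intro hu φ h
    have := hu _ ⟨φ, h, rfl⟩
    rwa [bdry_smoothPair, sub_eq_zero] at this

theorem isClosed_Hcurl : IsClosed (Hcurl Ω) := by
  rw [Hcurl_eq]
  exact isClosed_bdryAnnihilator _

theorem bdry_smoothPair_eq_zero {u : L2vec Ω × L2vec Ω} (hu : u ∈ Hcurl Ω) {φ : E3 → E3}
    (h : IsTest Ω φ) : bdry u (smoothPair Ω h.1 h.2.1) = 0 := by
  rw [bdry_smoothPair, hu φ h, sub_self]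

theorem smoothPair_mem_Hcurl {φ : E3 → E3} (hφ : ContDiff ℝ ∞ φ) (hc : HasCompactSupport φ) :
    smoothPair Ω hφ hc ∈ Hcurl Ω := by
  intro ψ hψ
  calc _ = ∫ x in Ω, inner ℝ (φ x) (curl ψ x) := by
        refine integral_congr_ae ?_
        filter_upwards [smoothPair_fst (Ω := Ω) hφ hc] with x hx
        rw [hx]
    _ = ∫ x in Ω, inner ℝ (curl φ x) (ψ x) := setIntegral_inner_curl hφ hψ
    _ = _ := by
        refine integral_congr_ae ?_
        filter_upwards [smoothPair_snd (Ω := Ω) hφ hc] with x hx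
        rw [hx]

/-- The smooth fields that vanish near `ΓD`; their closure is `HcurlD0 Ω ΓD`. -/
def smoothD0 (Ω ΓD : Set E3) : Submodule ℝ (L2vec Ω × L2vec Ω) where
  carrier := {v | v ∈ Hcurl Ω ∧ ∃ φ : E3 → E3, ContDiff ℝ ∞ φ ∧ HasCompactSupport φ ∧
    (∃ U, IsOpen U ∧ closure ΓD ⊆ U ∧ ∀ x ∈ U, φ x = 0) ∧
    v.1 =ᵐ[volume.restrict Ω] φ ∧ v.2 =ᵐ[volume.restrict Ω] curl φ}
  zero_mem' := by
    refine ⟨by rw [Hcurl_eq]; exact zero_mem _, 0, contDiff_const, HasCompactSupport.zero,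
      ⟨univ, isOpen_univ, subset_univ _, fun _ _ => rfl⟩, Lp.coeFn_zero _ _ _, ?_⟩
    filter_upwards [Lp.coeFn_zero E3 2 (volume.restrict Ω)] with x hx
    rw [Prod.snd_zero, hx, curl_eq_zero_of_notMem (by simp)]
    rfl
  add_mem' := by
    rintro v w ⟨hv, φ, hφ, hφc, ⟨U, hU, hUD, hUφ⟩, hv1, hv2⟩
      ⟨hw, ψ, hψ, hψc, ⟨W, hW, hWD, hWψ⟩, hw1, hw2⟩
    refine ⟨?_, φ + ψ, hφ.add hψ, hφc.add hψc, ⟨U ∩ W, hU.inter hW, subset_inter hUD hWD,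
      fun x hx => by simp [hUφ x hx.1, hWψ x hx.2]⟩, ?_, ?_⟩
    · rw [Hcurl_eq] at hv hw ⊢
      exact add_mem hv hw
    · exact (Lp.coeFn_add _ _).trans (hv1.add hw1)
    · filter_upwards [Lp.coeFn_add v.2 w.2, hv2, hw2] with x h h1 h2
      rw [Prod.snd_add, h, Pi.add_apply, h1, h2, curl_add hφ hψ]
  smul_mem' := by
    rintro c v ⟨hv, φ, hφ, hφc, ⟨U, hU, hUD, hUφ⟩, hv1, hv2⟩
    refine ⟨?_, c • φ, hφ.const_smul c, hφc.smul_left (f := fun _ => c), ⟨U, hU, hUD,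
      fun x hx => by simp [hUφ x hx]⟩, ?_, ?_⟩
    · rw [Hcurl_eq] at hv ⊢
      exact Submodule.smul_mem _ c hv
    · exact (Lp.coeFn_smul _ _).trans (hv1.const_smul c)
    · filter_upwards [Lp.coeFn_smul c v.2, hv2] with x h h1
      rw [Prod.smul_snd, h, Pi.smul_apply, h1, curl_const_smul hφ]

theorem HcurlD0_eq : HcurlD0 Ω ΓD = (smoothD0 Ω ΓD).topologicalClosure := rfl

theorem HcurlD0_subset : HcurlD0 Ω ΓD ⊆ Hcurl Ω :=
  closure_minimal (fun _ h => h.1) isClosed_Hcurl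

theorem smoothPair_mem_HcurlD0 (hd : Disjoint (closure ΓD) Ω) {φ : E3 → E3} (h : IsTest Ω φ) :
    smoothPair Ω h.1 h.2.1 ∈ HcurlD0 Ω ΓD := by
  refine subset_closure ⟨smoothPair_mem_Hcurl _ _, φ, h.1, h.2.1, ⟨(tsupport φ)ᶜ,
    (isClosed_tsupport φ).isOpen_compl, fun x hx hx' => hd.le_bot ⟨hx, h.2.2 hx'⟩,
    fun x hx => image_eq_zero_of_notMem_tsupport hx⟩, smoothPair_fst _ _, smoothPair_snd _ _⟩

/-- Membership in `H(curl;Ω)` is automatic, since the test fields belong to `HcurlD0 Ω ΓD`. -/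
theorem HcurlN0_eq (hd : Disjoint (closure ΓD) Ω) :
    HcurlN0 Ω ΓD = bdryAnnihilator (HcurlD0 Ω ΓD) := by
  ext τ
  constructor
  · rintro ⟨-, h⟩ v hv
    exact congrFun h ⟨v, hv⟩
  · intro h
    refine ⟨?_, funext fun v => h v.1 v.2⟩
    rw [Hcurl_eq]
    rintro _ ⟨φ, hφ, rfl⟩
    exact h _ (smoothPair_mem_HcurlD0 hd hφ)

/-- Smooth fields are piecewise `H¹`. -/
theorem fst_mem_PH1_of_mem_smoothD0 {m : ℕ} {P : Fin m → Set E3} (hP : IsPartition Ω P)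
    {v : L2vec Ω × L2vec Ω} (hv : v ∈ smoothD0 Ω ΓD) : v.1 ∈ PH1 Ω P := by
  obtain ⟨-, φ, hφ, hc, -, hv1, -⟩ := hv
  intro j i k
  refine ⟨partialD φ k i, (continuous_partialD hφ k i).memLp_of_hasCompactSupport
    (hc.mono' (support_partialD_subset φ k i)), fun ψ hψ => ?_⟩
  simp only [partialD_eq hφ]
  rw [← setIntegral_mul_fderiv (contDiff_apply hφ i) hψ]
  refine integral_congr_ae ?_
  filter_upwards [ae_restrict_of_ae_restrict_of_subset (hP.subset j) hv1] with x hx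
  rw [hx]

/-! ### Divergence-free representatives -/

/-- The closed subspace of `H(curl;Ω)` generated by the gradients of test functions, that is, the
gradients of `H¹₀(Ω)` with their curl `0`. -/
def gradTest (Ω : Set E3) : Submodule ℝ (L2vec Ω × L2vec Ω) :=
  (Submodule.span ℝ {v | ∃ (φ : E3 → ℝ) (h : IsTest Ω φ), v = smoothPair Ω
    (isTest_gradient h).1 (isTest_gradient h).2.1}).topologicalClosure

theorem gradTest_subset_HcurlD0 (hd : Disjoint (closure ΓD) Ω) :
    (gradTest Ω : Set (L2vec Ω × L2vec Ω)) ⊆ HcurlD0 Ω ΓD := by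
  rw [HcurlD0_eq, SetLike.coe_subset_coe]
  refine Submodule.topologicalClosure_minimal _ (Submodule.span_le.2 ?_)
    (Submodule.isClosed_topologicalClosure _)
  rintro _ ⟨φ, h, rfl⟩
  exact smoothPair_mem_HcurlD0 hd (isTest_gradient h)

theorem bdry_gradTest {k z : L2vec Ω × L2vec Ω} (hk : k ∈ gradTest Ω) (hz : z ∈ Hcurl Ω) :
    bdry k z = 0 := by
  have : gradTest Ω ≤ bdryAnnihilator (Hcurl Ω) := by
    refine Submodule.topologicalClosure_minimal _ (Submodule.span_le.2 ?_)
      (isClosed_bdryAnnihilator _)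
    rintro _ ⟨φ, h, rfl⟩ v hv
    rw [bdry_swap, bdry_smoothPair_eq_zero hv (isTest_gradient h), neg_zero]
  exact this hk z hz

/-- Subtracting a gradient changes neither the curl nor the tangential trace; the one that minimizes
the weighted norm makes `b v` divergence-free. -/
theorem exists_gradTest_hasWeakDiv {a b : E3 → ℝ} (ha : IsWeight Ω a) (hb : IsWeight Ω b)
    (v : L2vec Ω × L2vec Ω) : ∃ k ∈ gradTest Ω, HasWeakDiv Ω b (v - k).1 0 ∧
      ‖energyEquiv ha hb (v - k)‖ ≤ ‖energyEquiv ha hb v‖ := by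
  obtain ⟨k, hk, h⟩ := exists_mem_forall_inner_sub_eq_zero (energyEquiv ha hb) (gradTest Ω)
    (Submodule.isClosed_topologicalClosure _) v
  refine ⟨k, hk, fun φ hφ => ?_, ?_⟩
  · have h0 := h _ (Submodule.le_topologicalClosure _ (Submodule.subset_span ⟨φ, hφ, rfl⟩))
    have hφ' := isTest_gradient hφ
    rw [inner_energyEquiv, formA] at h0
    have h1 : ∫ x in Ω, (a x)⁻¹ * inner ℝ ((v - k).2 x) ((smoothPair Ω hφ'.1 hφ'.2.1).2 x) = 0 := by
      refine integral_eq_zero_of_ae ?_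
      filter_upwards [smoothPair_snd (Ω := Ω) hφ'.1 hφ'.2.1] with x hx
      rw [hx, curl_gradient hφ.1, inner_zero_right, mul_zero]
      rfl
    rw [h1, zero_add] at h0
    have h2 : ∫ x in Ω, (0 : L2 Ω) x * φ x = 0 := by
      refine integral_eq_zero_of_ae ?_
      filter_upwards [Lp.coeFn_zero ℝ 2 (volume.restrict Ω)] with x hx
      rw [hx]
      simp
    rw [h2, neg_zero, ← h0]
    refine integral_congr_ae ?_
    filter_upwards [smoothPair_fst (Ω := Ω) hφ'.1 hφ'.2.1] with x hx
    rw [hx, real_inner_comm, gradient, InnerProductSpace.toDual_symm_apply]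
  · have h0 := h k hk
    have h1 : energyEquiv ha hb v = energyEquiv ha hb (v - k) + energyEquiv ha hb k := by
      rw [← map_add, sub_add_cancel]
    rw [h1]
    exact norm_le_norm_add_of_inner_eq_zero h0

/-! ### Trace norms and energy norms -/

theorem norm_sq_energyEquiv {a b : E3 → ℝ} (ha : IsWeight Ω a) (hb : IsWeight Ω b)
    (w : L2vec Ω × L2vec Ω) : ‖energyEquiv ha hb w‖ ^ 2 =
      (∫ x in Ω, (a x)⁻¹ * ‖w.2 x‖ ^ 2) + ∫ x in Ω, b x * ‖w.1 x‖ ^ 2 := by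
  rw [← ha.norm_sq_sqrtMul_symm, ← hb.norm_sq_sqrtMul, ← real_inner_self_eq_norm_sq,
    inner_energyEquiv', real_inner_self_eq_norm_sq, real_inner_self_eq_norm_sq]

theorem le_infExtension {a b : E3 → ℝ} (ha : IsWeight Ω a) (hb : IsWeight Ω b)
    {C : Set (L2vec Ω × L2vec Ω)} {c : ℝ≥0∞}
    (h : ∀ w ∈ C, c ≤ ENNReal.ofReal ‖energyEquiv ha hb w‖) : c ≤ infExtension a b C := by
  refine le_iInf fun w => le_iInf fun d => le_iInf fun hw => (h w hw.1).trans ?_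
  refine ENNReal.ofReal_le_ofReal (Real.le_sqrt_of_sq_le ?_)
  have : 0 ≤ ∫ x in Ω, (b x)⁻¹ * (d x) ^ 2 := by
    refine integral_nonneg_of_ae ?_
    filter_upwards [hb.pos] with x hx
    simp only [Pi.zero_apply]
    positivity
  rw [norm_sq_energyEquiv]
  linarith

theorem infExtension_le {a b : E3 → ℝ} (ha : IsWeight Ω a) (hb : IsWeight Ω b)
    {C : Set (L2vec Ω × L2vec Ω)} {w : L2vec Ω × L2vec Ω} (hw : w ∈ C)
    (hd : HasWeakDiv Ω b w.1 0) : infExtension a b C ≤ ENNReal.ofReal ‖energyEquiv ha hb w‖ := by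
  refine iInf_le_of_le w (iInf_le_of_le 0 (iInf_le_of_le ⟨hw, hd⟩ ?_))
  refine ENNReal.ofReal_le_ofReal (Real.sqrt_le_iff.2 ⟨norm_nonneg _, ?_⟩)
  have : ∫ x in Ω, (b x)⁻¹ * ((0 : L2 Ω) x) ^ 2 = 0 := by
    refine integral_eq_zero_of_ae ?_
    filter_upwards [Lp.coeFn_zero ℝ 2 (volume.restrict Ω)] with x hx
    rw [hx]
    simp
  rw [norm_sq_energyEquiv, this, add_zero]

theorem halfNormN_le {a b : E3 → ℝ} (ha : IsWeight Ω a) (hb : IsWeight Ω b)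
    (hd : Disjoint (closure ΓD) Ω) (v : HcurlD0 Ω ΓD) :
    halfNormN a b v ≤ ENNReal.ofReal ‖energyEquiv ha hb v.1‖ := by
  obtain ⟨k, hk, hdiv, hle⟩ := exists_gradTest_hasWeakDiv ha hb v.1
  refine le_trans (infExtension_le ha hb ⟨?_, fun z hz => ?_⟩ hdiv) (ENNReal.ofReal_le_ofReal hle)
  · exact (smoothD0 Ω ΓD).topologicalClosure.sub_mem v.2 (gradTest_subset_HcurlD0 hd hk)
  · rw [bdry_sub_left, bdry_gradTest hk hz, sub_zero]

theorem halfNormD_le {a b : E3 → ℝ} (ha : IsWeight Ω a) (hb : IsWeight Ω b)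
    (hd : Disjoint (closure ΓD) Ω) {w : L2vec Ω × L2vec Ω} (hw : w ∈ Hcurl Ω) :
    halfNormD a b (traceD ΓD w) ≤ ENNReal.ofReal ‖energyEquiv ha hb w‖ := by
  obtain ⟨k, hk, hdiv, hle⟩ := exists_gradTest_hasWeakDiv ha hb w
  refine le_trans (infExtension_le ha hb ⟨?_, funext fun τ => ?_⟩ hdiv)
    (ENNReal.ofReal_le_ofReal hle)
  · have h2 := HcurlD0_subset (gradTest_subset_HcurlD0 hd hk)
    rw [Hcurl_eq] at hw h2 ⊢
    exact sub_mem hw h2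
  · rw [traceD, traceD, bdry_sub_left, bdry_gradTest hk τ.2.1, sub_zero]

theorem negHalfNormN_traceN_ne_top {a b : E3 → ℝ} (ha : IsWeight Ω a) (hb : IsWeight Ω b)
    {m : ℕ} (P : Fin m → Set E3) {u : L2vec Ω × L2vec Ω} (hu : u ∈ Hcurl Ω) :
    negHalfNormN P b a (traceN ΓD u) ≠ ⊤ := by
  -- The added `1` makes the bound positive, so that one can divide by it.
  set C : ℝ := ‖energyEquiv hb ha u‖ + 1
  have hC : 0 < C := by positivity
  have : negHalfNormN P b a (traceN ΓD u) ≤ ENNReal.ofReal C := by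
    refine iSup_le fun v => iSup_le fun _ => ENNReal.div_le_of_le_mul ?_
    have h : ENNReal.ofReal (traceN ΓD u v / C) ≤ halfNormN a b v := by
      refine le_infExtension ha hb fun w hw => ENNReal.ofReal_le_ofReal ?_
      rw [div_le_iff₀ hC]
      calc traceN ΓD u v = - bdry v.1 u := bdry_swap _ _
        _ = - bdry w u := by rw [hw.2 u hu]
        _ ≤ |bdry w u| := neg_le_abs _
        _ ≤ ‖energyEquiv ha hb w‖ * ‖energyEquiv hb ha u‖ := abs_bdry_le ha hb w u
        _ ≤ ‖energyEquiv ha hb w‖ * C := by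
            gcongr
            exact le_add_of_nonneg_right zero_le_one
    calc ENNReal.ofReal (traceN ΓD u v)
        = ENNReal.ofReal C * ENNReal.ofReal (traceN ΓD u v / C) := by
          rw [← ENNReal.ofReal_mul hC.le, mul_div_cancel₀ _ hC.ne']
      _ ≤ _ := by gcongr
  exact ne_top_of_le_ne_top ENNReal.ofReal_ne_top this

/-- The supremum over piecewise `H¹` fields controls the trace on all of `HcurlD0 Ω ΓD`, because
smooth fields are dense there and the trace norm is bounded by the energy norm. -/
theorem bdry_le_negHalfNormN {a b : E3 → ℝ} (ha : IsWeight Ω a) (hb : IsWeight Ω b)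
    (hd : Disjoint (closure ΓD) Ω) {m : ℕ} {P : Fin m → Set E3} (hP : IsPartition Ω P)
    {u : L2vec Ω × L2vec Ω} (hu : u ∈ Hcurl Ω) {v : L2vec Ω × L2vec Ω} (hv : v ∈ HcurlD0 Ω ΓD) :
    bdry u v ≤ (negHalfNormN P b a (traceN ΓD u)).toReal * ‖energyEquiv ha hb v‖ := by
  have hfin := negHalfNormN_traceN_ne_top (ΓD := ΓD) ha hb P hu
  refine closure_minimal (t := {v | bdry u v ≤ _ * ‖energyEquiv ha hb v‖}) ?_
    (isClosed_le (continuous_bdry_right u)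
      (continuous_const.mul (energyEquiv ha hb).continuous.norm)) hv
  intro v hv
  set v' : HcurlD0 Ω ΓD := ⟨v, subset_closure hv⟩
  have h1 : ENNReal.ofReal (bdry u v) / halfNormN a b v' ≤ negHalfNormN P b a (traceN ΓD u) :=
    le_iSup₂_of_le v' (fst_mem_PH1_of_mem_smoothD0 hP hv) le_rfl
  have h2 := halfNormN_le ha hb hd v'
  rw [ENNReal.div_le_iff_le_mul (Or.inr hfin)
    (Or.inl (ne_top_of_le_ne_top ENNReal.ofReal_ne_top h2))] at h1
  have h3 := h1.trans (mul_le_mul_right h2 _)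
  rw [← ENNReal.ofReal_toReal hfin, ← ENNReal.ofReal_mul ENNReal.toReal_nonneg] at h3
  exact (ENNReal.ofReal_le_ofReal_iff (by positivity)).1 h3

end

/-! ### The variational problem -/

section

variable {Ω ΓD : Set E3} {μ β : E3 → ℝ}

/-- With `w × n = gD` on `ΓD`, the data of the variational problem are represented in the energy
inner product by `(0, f) - w*`. -/
theorem formA_eq_iff (hμ : IsWeight Ω μ) (hβ : IsWeight Ω β) (f : L2vec Ω)
    (w σ τ : L2vec Ω × L2vec Ω) :
    formA β μ σ τ = (∫ x in Ω, (β x)⁻¹ * inner ℝ (f x) (τ.2 x)) - bdry w τ ↔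
      inner ℝ (energyEquiv hβ hμ (σ - ((0, f) - bdryRep hμ hβ w))) (energyEquiv hβ hμ τ)
        = (0 : ℝ) := by
  have hf : ∫ x in Ω, (β x)⁻¹ * inner ℝ (f x) (τ.2 x) =
      inner ℝ (energyEquiv hβ hμ (0, f)) (energyEquiv hβ hμ τ) := by
    rw [inner_energyEquiv', hβ.inner_sqrtMul_symm, map_zero, inner_zero_left, add_zero]
  have h1 := inner_energyEquiv_sub_left hβ hμ σ ((0, f) - bdryRep hμ hβ w) τ
  have h2 := inner_energyEquiv_sub_left hβ hμ (0, f) (bdryRep hμ hβ w) τ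
  rw [hf, bdry_eq_inner_energyEquiv hμ hβ, ← inner_energyEquiv hβ hμ]
  constructor <;> intro h <;> linarith

/-- Any extension `u` of `gN`, corrected by the energy projection onto the fields with zero trace on
`ΓN`. -/
theorem exists_isMagSolution (hμ : IsWeight Ω μ) (hβ : IsWeight Ω β)
    (hd : Disjoint (closure ΓD) Ω) (f : L2vec Ω)
    (w : L2vec Ω × L2vec Ω) {u : L2vec Ω × L2vec Ω} (hu : u ∈ Hcurl Ω) :
    ∃ σ, IsMagSolution μ β f (traceD ΓD w) (traceN ΓD u) σ := by
  have hN := HcurlN0_eq hd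
  obtain ⟨k, hk, h⟩ := exists_mem_forall_inner_sub_eq_zero (energyEquiv hβ hμ)
    (bdryAnnihilator (HcurlD0 Ω ΓD)) (isClosed_bdryAnnihilator _)
    (u - ((0, f) - bdryRep hμ hβ w))
  refine ⟨u - k, ?_, funext fun v => ?_, fun τ => ?_⟩
  · have hk' : k ∈ HcurlN0 Ω ΓD := hN ▸ hk
    have hk'' := hk'.1
    rw [Hcurl_eq] at hu hk'' ⊢
    exact sub_mem hu hk''
  · rw [traceN, traceN, bdry_sub_left, hk v.1 v.2, sub_zero]
  · refine (formA_eq_iff hμ hβ f w _ _).2 ?_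
    rw [sub_right_comm]
    exact h τ.1 (hN ▸ τ.2 : τ.1 ∈ (bdryAnnihilator (HcurlD0 Ω ΓD) : Set _))

theorem IsMagSolution.sub_mem_HcurlN0 {f f' : L2vec Ω} {gD gD' : HcurlN0 Ω ΓD → ℝ}
    {gN : HcurlD0 Ω ΓD → ℝ} {σ σ' : L2vec Ω × L2vec Ω} (h : IsMagSolution μ β f gD gN σ)
    (h' : IsMagSolution μ β f' gD' gN σ') : σ - σ' ∈ HcurlN0 Ω ΓD := by
  refine ⟨?_, funext fun v => ?_⟩
  · have h1 := h.1
    have h2 := h'.1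
    rw [Hcurl_eq] at h1 h2 ⊢
    exact sub_mem h1 h2
  · have h1 := congrFun (h.2.1.trans h'.2.1.symm) v
    simp only [traceN, bdry_sub_left, Pi.zero_apply] at h1 ⊢
    rw [h1, sub_self]

/-- Two solutions with the same `gN`, one of them for `f = 0` and `gD = 0`, differ by an admissible
test field, which may be inserted into the equation of their difference. -/
theorem IsMagSolution.norm_sub_le (hμ : IsWeight Ω μ) (hβ : IsWeight Ω β)
    {f : L2vec Ω} {w : L2vec Ω × L2vec Ω}
    {gN : HcurlD0 Ω ΓD → ℝ} {σ σ' : L2vec Ω × L2vec Ω}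
    (h : IsMagSolution μ β f (traceD ΓD w) gN σ)
    (h' : IsMagSolution μ β 0 (traceD ΓD 0) gN σ') :
    ‖energyEquiv hβ hμ (σ - σ')‖ ≤
      ‖energyEquiv hβ hμ (0, f)‖ + ‖energyEquiv hμ hβ w‖ := by
  have hmem := h.sub_mem_HcurlN0 h'
  have h1 := (formA_eq_iff hμ hβ f w _ _).1 (h.2.2 ⟨_, hmem⟩)
  have h2 := (formA_eq_iff hμ hβ 0 0 _ _).1 (h'.2.2 ⟨_, hmem⟩)
  have h0 : ((0 : L2vec Ω), (0 : L2vec Ω)) - bdryRep hμ hβ 0 = 0 := by simp [bdryRep]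
  rw [h0, sub_zero] at h2
  have h3 : inner ℝ (energyEquiv hβ hμ (σ - σ')) (energyEquiv hβ hμ (σ - σ')) =
      inner ℝ (energyEquiv hβ hμ ((0, f) - bdryRep hμ hβ w)) (energyEquiv hβ hμ (σ - σ')) := by
    have h5 := inner_energyEquiv_sub_left hβ hμ σ ((0, f) - bdryRep hμ hβ w) (σ - σ')
    have h6 := inner_energyEquiv_sub_left hβ hμ σ σ' (σ - σ')
    linarith
  have h4 := h3.trans_le (real_inner_le_norm _ _)
  rw [real_inner_self_eq_norm_mul_norm] at h4
  have h5 : ‖energyEquiv hβ hμ ((0, f) - bdryRep hμ hβ w)‖ ≤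
      ‖energyEquiv hβ hμ (0, f)‖ + ‖energyEquiv hμ hβ w‖ := by
    rw [← norm_energyEquiv_bdryRep hμ hβ w]
    exact norm_energyEquiv_sub_le hβ hμ _ _
  rcases (norm_nonneg (energyEquiv hβ hμ (σ - σ'))).eq_or_lt with h6 | h6
  · rw [← h6]
    positivity
  · exact (le_of_mul_le_mul_right h4 h6).trans h5

theorem IsMagSolution.eq (hμ : IsWeight Ω μ) (hβ : IsWeight Ω β)
    {f : L2vec Ω} {w : L2vec Ω × L2vec Ω}
    {gN : HcurlD0 Ω ΓD → ℝ} {σ σ' : L2vec Ω × L2vec Ω}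
    (h : IsMagSolution μ β f (traceD ΓD w) gN σ)
    (h' : IsMagSolution μ β f (traceD ΓD w) gN σ') : σ = σ' := by
  have hmem := h.sub_mem_HcurlN0 h'
  have h1 := (formA_eq_iff hμ hβ f w _ _).1 (h.2.2 ⟨_, hmem⟩)
  have h2 := (formA_eq_iff hμ hβ f w _ _).1 (h'.2.2 ⟨_, hmem⟩)
  have h3 : inner ℝ (energyEquiv hβ hμ (σ - σ')) (energyEquiv hβ hμ (σ - σ')) = (0 : ℝ) := by
    nth_rewrite 1 [← sub_sub_sub_cancel_right σ σ' ((0, f) - bdryRep hμ hβ w)]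
    rw [inner_energyEquiv_sub_left, h1, h2, sub_zero]
  have h4 := inner_self_eq_zero.1 h3
  exact sub_eq_zero.1 ((energyEquiv hβ hμ).map_eq_zero_iff.1 h4)

/-- For `f = 0` and `gD = 0` the equation says that the pair `σ* = (-β⁻¹ curl σ, μ σ)` annihilates
the graph adjoint of `HcurlD0 Ω ΓD`. Hence `σ*` is a member of that space; in particular its second
component is the weak curl of the first. -/
theorem IsMagSolution.bdryRep_mem_HcurlD0 (hμ : IsWeight Ω μ) (hβ : IsWeight Ω β)
    (hd : Disjoint (closure ΓD) Ω)
    {gN : HcurlD0 Ω ΓD → ℝ} {σ : L2vec Ω × L2vec Ω}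
    (h : IsMagSolution μ β 0 (traceD ΓD 0) gN σ) : bdryRep hβ hμ σ ∈ HcurlD0 Ω ΓD := by
  refine mem_of_adjoint_adjoint (smoothD0 Ω ΓD).topologicalClosure
    (Submodule.isClosed_topologicalClosure _) _ fun τ hτ => ?_
  have hτ' : τ ∈ HcurlN0 Ω ΓD := by
    rw [HcurlN0_eq hd]
    exact hτ
  have h1 := (formA_eq_iff hμ hβ 0 0 _ _).1 (h.2.2 ⟨τ, hτ'⟩)
  have h0 : ((0 : L2vec Ω), (0 : L2vec Ω)) - bdryRep hμ hβ 0 = 0 := by simp [bdryRep]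
  rw [h0, sub_zero] at h1
  have h2 : bdryRep hμ hβ (bdryRep hβ hμ σ) = -σ := by
    simp [bdryRep, Prod.ext_iff]
  have h3 := bdry_eq_inner_energyEquiv hμ hβ (bdryRep hβ hμ σ) τ
  rw [h2, map_neg, inner_neg_left, h1, neg_zero] at h3
  exact h3

/-- The field `σ* ∈ HcurlD0 Ω ΓD` satisfies `⟨gN, σ*⟩ = |||σ|||²`, and its energy norm is
`|||σ|||`. -/
theorem IsMagSolution.norm_le (hμ : IsWeight Ω μ) (hβ : IsWeight Ω β)
    (hd : Disjoint (closure ΓD) Ω) {m : ℕ} {P : Fin m → Set E3}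
    (hP : IsPartition Ω P) {gN : HcurlD0 Ω ΓD → ℝ} {σ : L2vec Ω × L2vec Ω}
    (h : IsMagSolution μ β 0 (traceD ΓD 0) gN σ) :
    ‖energyEquiv hβ hμ σ‖ ≤ (negHalfNormN P β μ gN).toReal := by
  have h1 := bdry_le_negHalfNormN hμ hβ hd hP h.1 (h.bdryRep_mem_HcurlD0 hμ hβ hd)
  rw [h.2.1, bdry_eq_inner_energyEquiv hβ hμ, norm_energyEquiv_bdryRep,
    real_inner_self_eq_norm_mul_norm, norm_energyEquiv_bdryRep] at h1
  rcases (norm_nonneg (energyEquiv hβ hμ σ)).eq_or_lt with h6 | h6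
  · rw [← h6]
    exact ENNReal.toReal_nonneg
  · exact le_of_mul_le_mul_right h1 h6

theorem IsMagSolution.ofReal_energyNorm_le (hμ : IsWeight Ω μ) (hβ : IsWeight Ω β)
    (hd : Disjoint (closure ΓD) Ω) {m : ℕ}
    {P : Fin m → Set E3} (hP : IsPartition Ω P) {f : L2vec Ω} {gD : HcurlN0 Ω ΓD → ℝ}
    {u : L2vec Ω × L2vec Ω} (hu : u ∈ Hcurl Ω) {σ : L2vec Ω × L2vec Ω}
    (h : IsMagSolution μ β f gD (traceN ΓD u) σ) :
    ENNReal.ofReal (energyNorm β μ σ) ≤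
      ENNReal.ofReal √(∫ x in Ω, (β x)⁻¹ * ‖f x‖ ^ 2)
        + halfNormD μ β gD + negHalfNormN P β μ (traceN ΓD u) := by
  -- `σ'` carries the data `gN`; the rest `σ - σ'` is caused by `f` and `gD`.
  obtain ⟨σ', h'⟩ := exists_isMagSolution hμ hβ hd 0 0 hu
  have hf : √(∫ x in Ω, (β x)⁻¹ * ‖f x‖ ^ 2) = ‖energyEquiv hβ hμ (0, f)‖ := by
    rw [← hβ.norm_sq_sqrtMul_symm, Real.sqrt_sq (norm_nonneg _), ← sq_eq_sq₀ (norm_nonneg _)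
      (norm_nonneg _), ← real_inner_self_eq_norm_sq (energyEquiv hβ hμ (0, f)),
      inner_energyEquiv', map_zero, inner_zero_left, add_zero, real_inner_self_eq_norm_sq]
  have h1 : ENNReal.ofReal (‖energyEquiv hβ hμ (σ - σ')‖ - ‖energyEquiv hβ hμ (0, f)‖) ≤
      halfNormD μ β gD := by
    refine le_infExtension hμ hβ fun w hw => ENNReal.ofReal_le_ofReal ?_
    rw [sub_le_iff_le_add']
    obtain ⟨-, rfl⟩ := hw
    exact h.norm_sub_le hμ hβ h'
  have h2 : ENNReal.ofReal ‖energyEquiv hβ hμ σ'‖ ≤ negHalfNormN P β μ (traceN ΓD u) :=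
    (ENNReal.ofReal_le_ofReal (h'.norm_le hμ hβ hd hP)).trans ENNReal.ofReal_toReal_le
  have h3 : ‖energyEquiv hβ hμ σ‖ ≤ ‖energyEquiv hβ hμ (0, f)‖ +
      (‖energyEquiv hβ hμ (σ - σ')‖ - ‖energyEquiv hβ hμ (0, f)‖) +
      ‖energyEquiv hβ hμ σ'‖ := by
    have h4 : energyEquiv hβ hμ σ = energyEquiv hβ hμ (σ - σ') + energyEquiv hβ hμ σ' := by
      rw [← map_add, sub_add_cancel]
    rw [add_sub_cancel, h4]
    exact norm_add_le _ _
  rw [hf, energyNorm_eq hβ hμ]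
  calc _ ≤ _ := ENNReal.ofReal_le_ofReal h3
    _ ≤ _ := ENNReal.ofReal_add_le
    _ ≤ _ := add_le_add ENNReal.ofReal_add_le le_rfl
    _ ≤ _ := add_le_add (add_le_add le_rfl h1) h2

end

theorem IsCoefficientPair.isWeight_beta {Ω : Set E3} {μ β : E3 → ℝ}
    (h : IsCoefficientPair Ω μ β) : IsWeight Ω β :=
  isWeight_of_memLp h.memLp_beta h.lower_beta

theorem IsCoefficientPair.isWeight_mu {Ω : Set E3} {μ β : E3 → ℝ}
    (h : IsCoefficientPair Ω μ β) : IsWeight Ω μ := by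
  obtain ⟨μ₀, h0, hl⟩ := h.lower_mu
  simpa using (isWeight_of_memLp h.memLp_mu ⟨μ₀⁻¹, inv_pos.2 h0, hl⟩).inv

theorem IsBoundarySplitting.disjoint_closure {Ω ΓD ΓN : Set E3}
    (h : IsBoundarySplitting Ω ΓD ΓN) (hΩ : IsOpen Ω) : Disjoint (closure ΓD) Ω := by
  have : closure ΓD ⊆ frontier Ω := h.cover ▸ subset_union_left
  exact (disjoint_frontier_iff_isOpen.2 hΩ).mono_left this

end MagField

end

theorem theorem3p1 (Ω ΓD ΓN : Set MagField.E3) (hΩ : MagField.IsPolyhedralDomain Ω)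
    (hsc : SimplyConnectedSpace Ω) (hΓ : MagField.IsBoundarySplitting Ω ΓD ΓN)
    {m : ℕ} (P : Fin m → Set MagField.E3) (hP : MagField.IsPartition Ω P)
    (μ β : MagField.E3 → ℝ) (hc : MagField.IsCoefficientPair Ω μ β)
    (f : MagField.L2vec Ω)
    (gD : MagField.HcurlN0 Ω ΓD → ℝ) (hgD : gD ∈ MagField.HhalfPerpD Ω ΓD P)
    (gN : MagField.HcurlD0 Ω ΓD → ℝ) (hgN : gN ∈ MagField.XparN Ω ΓD) :
    (∃! σ, MagField.IsMagSolution μ β f gD gN σ) ∧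
    (MagField.halfNormD μ β gD ≠ ⊤ ∧ MagField.negHalfNormN P β μ gN ≠ ⊤) ∧
    ∀ σ, MagField.IsMagSolution μ β f gD gN σ →
      ENNReal.ofReal (MagField.energyNorm β μ σ) ≤
        ENNReal.ofReal √(∫ x in Ω, (β x)⁻¹ * ‖f x‖ ^ 2)
          + MagField.halfNormD μ β gD + MagField.negHalfNormN P β μ gN := by
  have hμ := hc.isWeight_mu
  have hβ := hc.isWeight_beta
  have hd := hΓ.disjoint_closure hΩ.isOpen
  obtain ⟨w, ⟨hw, -⟩, rfl⟩ := hgD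
  obtain ⟨u, hu, rfl⟩ := hgN
  obtain ⟨σ, hσ⟩ := MagField.exists_isMagSolution hμ hβ hd f w hu
  exact ⟨⟨σ, hσ, fun σ' hσ' => hσ'.eq hμ hβ hσ⟩,
    ⟨ne_top_of_le_ne_top ENNReal.ofReal_ne_top (MagField.halfNormD_le hμ hβ hd hw),
      MagField.negHalfNormN_traceN_ne_top hμ hβ P hu⟩,
    fun σ' hσ' => hσ'.ofReal_energyNorm_le hμ hβ hd hP hu⟩
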